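/- Let $l$ be a prime number, let $\mathcal T_l$ be an abelian pro-$l$ group that is isomorphic, as a topological group, to $\prod_{k\in\mathbb N}\mathbb Z/l^k\mathbb Z$ (product topology, finite factors discrete), and let $A$ be a finite abelian $l$-group with the discrete topology. Then there exists an abelian pro-$l$ group $\mathcal D_l$, unique up to isomorphism of topological groups, for which there is an exact sequence of abelian pro-$l$ groups with continuous homomorphisms $$0\to\mathcal T_l\xrightarrow{\,i\,}\mathcal D_l\to A\to 0$$ such that the topological closure of the torsion subgroup of $\mathcal D_l$ is exactly the image $i(\mathcal T_l)$. Here an abelian pro-$l$ group is a profinite abelian group in which the index of every open subgroup is a power of $l$. -/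

import Mathlib

/-- A commutative topological group, written additively, is pro-`l` if it is profinite (a compact,
Hausdorff and totally disconnected topological group) and each of its open subgroups has
index a power of `l`. -/
structure IsAddProLGroup (l : ℕ) (G : Type*) [AddCommGroup G] [TopologicalSpace G] : Prop where
  isTopologicalAddGroup : IsTopologicalAddGroup G
  compactSpace : CompactSpace G
  t2Space : T2Space G
  totallyDisconnectedSpace : TotallyDisconnectedSpace G
  index_eq_pow : ∀ U : OpenAddSubgroup G, ∃ n : ℕ, (U : AddSubgroup G).index = l ^ n

/-- `D` is an extension of `A` by `T`, with continuous homomorphisms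
`0 → T → D → A → 0`, in which the closure of the torsion subgroup of `D` is exactly (the image
of) `T`. -/
def IsTorsionClosureExtension (T D A : Type*)
    [AddCommGroup T] [TopologicalSpace T] [AddCommGroup D] [TopologicalSpace D]
    [AddCommGroup A] [TopologicalSpace A] : Prop :=
  ∃ (i : T →ₜ+ D) (q : D →ₜ+ A),
    Function.Injective i ∧ Function.Exact i q ∧ Function.Surjective q ∧
      closure (AddCommGroup.torsion D : Set D) = Set.range i

/-!
Let `|A| = l ^ N` and let `φ : ℕ → (A →+ ZMod (l ^ N))` be a sequence of characters. The group
`charFiberProduct φ` of pairs `(x, a)` with `x k ∈ ZMod (l ^ (k + N))` reducing to `φ k a` modulo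
`l ^ N` is a closed subgroup of a profinite group, hence pro-`l`, and an extension of `A` by
`∏ k, l ^ N ZMod (l ^ (k + N)) ≃ ∏ k, ZMod (l ^ k)`.

Every extension of `A` by `∏ k, ZMod (l ^ k)` has this form
(`exists_continuousAddEquiv_charFiberProduct`): since `ℚ/ℤ` is injective, the coordinate maps
extend to homomorphisms into `ZMod (l ^ (k + N))`, which modulo `l ^ N` factor through `A`.

An element `a` lifts to a torsion element exactly when `φ k a = 0` for almost all `k`. As the torsion
subgroup of `∏ k, ZMod (l ^ k)` is dense, the closure of the torsion subgroup of the fibre product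
is the kernel of the projection to `A` if and only if every `a ≠ 0` has `φ k a ≠ 0` for infinitely
many `k`. Existence follows by letting `φ` run through all characters, each infinitely often.

For uniqueness, adding to the coordinate `x k` an integral combination of coordinates `x s` with
`s ≥ k` adds the same combination of the `φ s` to `φ k`. If the `φ s` with `s ∈ S` separate
the points of `A` infinitely often, then by duality for finite groups those with `s ≥ k` generate all
characters, so such a shear changes the `φ k` with `k ∉ S` into arbitrary characters
(`nonempty_continuousAddEquiv_of_eqOn`). Given two sequences `φ` and `ψ`, split `ℕ` into `S` and its
complement so that each value taken infinitely often by `(φ, ψ)` is taken infinitely often on both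
parts (`exists_infinite_fiber_split`). Then the fibre products of `φ` and of `ψ` are both isomorphic
to that of the sequence which is `φ` on `S` and `ψ` off `S`
(`nonempty_continuousAddEquiv_charFiberProduct`).
-/

/-! ### Characters of finite groups with values in `ZMod n` -/

theorem hasEnoughRootsOfUnity_multiplicative_zmod (n : ℕ) :
    HasEnoughRootsOfUnity (Multiplicative (ZMod n)) n where
  prim := ⟨.ofAdd 1, by
    have h := IsPrimitiveRoot.orderOf (Multiplicative.ofAdd (1 : ZMod n))
    rwa [orderOf_ofAdd_eq_addOrderOf, ZMod.addOrderOf_one] at h⟩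
  cyc := by
    have : IsCyclic (Multiplicative (ZMod n))ˣ :=
      isCyclic_of_surjective _ (toUnits (G := Multiplicative (ZMod n))).surjective
    infer_instance

section Duality

variable {A : Type*} [AddCommGroup A] {n : ℕ} [NeZero n]

theorem hasEnoughRootsOfUnity_zmod_exponent (hA : ∀ a : A, n • a = 0) :
    HasEnoughRootsOfUnity (Multiplicative (ZMod n)) (Monoid.exponent (Multiplicative A)) :=
  have := hasEnoughRootsOfUnity_multiplicative_zmod n
  .of_dvd _ (n := n) (Monoid.exponent_dvd_of_forall_pow_eq_one fun a ↦ hA a.toAdd)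

/-- Additive characters `A →+ ZMod n` as multiplicative characters with values in units. -/
def zmodCharEquiv (A : Type*) [AddCommGroup A] (n : ℕ) :
    (A →+ ZMod n) ≃ (Multiplicative A →* (Multiplicative (ZMod n))ˣ) :=
  AddMonoidHom.toMultiplicative.trans
    (MulEquiv.monoidHomCongrRightEquiv (toUnits (G := Multiplicative (ZMod n))))

omit [NeZero n] in
theorem zmodCharEquiv_apply (χ : A →+ ZMod n) (g : Multiplicative A) :
    zmodCharEquiv A n χ g = toUnits (Multiplicative.ofAdd (χ g.toAdd)) := rfl

variable [Finite A]

theorem exists_zmodChar_ne_zero (hA : ∀ a : A, n • a = 0) {a : A} (ha : a ≠ 0) :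
    ∃ χ : A →+ ZMod n, χ a ≠ 0 := by
  have := hasEnoughRootsOfUnity_zmod_exponent hA
  obtain ⟨φ, hφ⟩ := CommGroup.exists_apply_ne_one_of_hasEnoughRootsOfUnity (Multiplicative A)
    (Multiplicative (ZMod n)) (a := .ofAdd a) ha
  refine ⟨(zmodCharEquiv A n).symm φ, fun h ↦ hφ ?_⟩
  rw [← (zmodCharEquiv A n).apply_symm_apply φ, zmodCharEquiv_apply, toAdd_ofAdd, h, ofAdd_zero,
    map_one]

theorem finite_zmodChar : Finite (A →+ ZMod n) :=
  Finite.of_injective (fun f a ↦ f a) DFunLike.coe_injective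

/-- A group of characters that separates the points of `A` consists of all characters, since
under the duality between subgroups of `A` and of its character group it corresponds to the trivial
subgroup. -/
theorem zmodChar_subgroup_eq_top (hA : ∀ a : A, n • a = 0) (H : AddSubgroup (A →+ ZMod n))
    (hH : ∀ a : A, a ≠ 0 → ∃ χ ∈ H, χ a ≠ 0) : H = ⊤ := by
  have := hasEnoughRootsOfUnity_zmod_exponent hA
  let e := CommGroup.subgroupOrderIsoSubgroupMonoidHom (Multiplicative A)
    (Multiplicative (ZMod n))
  let H' : Subgroup (Multiplicative A →* (Multiplicative (ZMod n))ˣ) :=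
    { carrier := zmodCharEquiv A n '' H
      one_mem' := ⟨0, H.zero_mem, by ext; simp [zmodCharEquiv_apply]⟩
      mul_mem' := by
        rintro _ _ ⟨a, ha, rfl⟩ ⟨b, hb, rfl⟩
        exact ⟨a + b, H.add_mem ha hb, by ext; simp [zmodCharEquiv_apply]⟩
      inv_mem' := by
        rintro _ ⟨a, ha, rfl⟩
        exact ⟨-a, H.neg_mem ha, by ext; simp [zmodCharEquiv_apply]⟩ }
  have h1 : e.symm (OrderDual.toDual H') = ⊥ := by
    rw [eq_bot_iff]
    intro g hg
    rw [CommGroup.mem_subgroupOrderIsoSubgroupMonoidHom_symm_iff] at hg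
    by_contra hne
    obtain ⟨χ, hχ, h⟩ := hH g.toAdd hne
    have hg' := hg _ ⟨χ, hχ, rfl⟩
    rw [zmodCharEquiv_apply, EmbeddingLike.map_eq_one_iff] at hg'
    exact h hg'
  have h2 : H' = ⊤ := by
    have := congrArg e h1
    rw [e.apply_symm_apply, map_bot] at this
    exact this
  rw [eq_top_iff]
  intro χ _
  have : zmodCharEquiv A n χ ∈ H' := h2 ▸ trivial
  obtain ⟨χ', h, he⟩ := this
  exact (zmodCharEquiv A n).injective he ▸ h

end Duality

/-! ### Extension of homomorphisms to `ZMod n` -/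

/-- The embedding of `ZMod n` into `ℚ/ℤ` that takes `1` to `1 / n`. -/
noncomputable def zmodToRatCircle (n : ℕ) [NeZero n] : ZMod n →+ AddCircle (1 : ℚ) :=
  ZMod.lift n ⟨zmultiplesHom _ (((1 : ℚ) / n : ℚ) : AddCircle (1 : ℚ)), by
    have : (n : ℚ) ≠ 0 := NeZero.ne _
    rw [zmultiplesHom_apply, ← AddCircle.coe_zsmul, AddCircle.coe_eq_zero_iff]
    exact ⟨1, by simp [this]⟩⟩

theorem zmodToRatCircle_intCast (n : ℕ) [NeZero n] (m : ℤ) :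
    zmodToRatCircle n m = ((m / n : ℚ) : AddCircle (1 : ℚ)) := by
  rw [zmodToRatCircle, ZMod.lift_coe, zmultiplesHom_apply, ← AddCircle.coe_zsmul]
  simp [div_eq_mul_inv]

theorem zmodToRatCircle_injective (n : ℕ) [NeZero n] :
    Function.Injective (zmodToRatCircle n) := by
  have hn : (n : ℚ) ≠ 0 := NeZero.ne _
  rw [injective_iff_map_eq_zero]
  intro a ha
  obtain ⟨m, rfl⟩ := ZMod.intCast_surjective a
  rw [zmodToRatCircle_intCast, AddCircle.coe_eq_zero_iff] at ha
  obtain ⟨c, hc⟩ := ha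
  rw [ZMod.intCast_zmod_eq_zero_iff_dvd]
  refine ⟨c, ?_⟩
  rw [zsmul_one, eq_div_iff hn] at hc
  rw [mul_comm]
  exact_mod_cast hc.symm

theorem mem_range_zmodToRatCircle {n : ℕ} [NeZero n] {x : AddCircle (1 : ℚ)} (hx : n • x = 0) :
    ∃ a, zmodToRatCircle n a = x := by
  have hn : (n : ℚ) ≠ 0 := NeZero.ne _
  obtain ⟨q, rfl⟩ := QuotientAddGroup.mk_surjective x
  obtain ⟨c, hc⟩ := AddCircle.coe_eq_zero_iff (p := (1 : ℚ)) (x := n • q) |>.1 hx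
  refine ⟨c, ?_⟩
  rw [zmodToRatCircle_intCast]
  congr 1
  rw [zsmul_one, nsmul_eq_mul] at hc
  rw [hc]
  field_simp

/-- A homomorphism `f : H →+ ZMod n` extends to a group containing `H`, provided its multiples by
`n` lie in the kernel of `f`: extend `f` as a character with values in the injective group
`ℚ/ℤ`; the extension then takes values in the `n`-torsion of `ℚ/ℤ`, which is `ZMod n`. -/
theorem exists_zmodHom_extension {H G : Type*} [AddCommGroup H] [AddCommGroup G] {n : ℕ} [NeZero n]
    (i : H →+ G) (hi : Function.Injective i) (f : H →+ ZMod n)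
    (hf : ∀ g : G, ∃ h, f h = 0 ∧ i h = n • g) :
    ∃ F : G →+ ZMod n, ∀ h, F (i h) = f h := by
  obtain ⟨X, hX⟩ := CharacterModule.dual_surjective_of_injective i.toIntLinearMap hi
    ((zmodToRatCircle n).comp f : H →+ AddCircle (1 : ℚ))
  have hX' (h : H) : X (i h) = zmodToRatCircle n (f h) := DFunLike.congr_fun hX h
  have hmem (g : G) : ∃ a, zmodToRatCircle n a = X g := by
    apply mem_range_zmodToRatCircle
    obtain ⟨h, h0, hg⟩ := hf g
    rw [← map_nsmul, ← hg, hX', h0, map_zero]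
  choose F hF using hmem
  have hinj := zmodToRatCircle_injective n
  refine ⟨AddMonoidHom.mk' F fun a b ↦ hinj ?_, fun h ↦ hinj ?_⟩
  · rw [map_add, hF, hF, hF, map_add]
  · exact (hF _).trans (hX' h)

/-! ### Infinite fibres of sequences -/

/-- `ℕ` can be split into two parts such that every value taken infinitely often by `f` is taken
infinitely often on both parts. -/
theorem exists_infinite_fiber_split {β : Type*} (f : ℕ → β) :
    ∃ S : Set ℕ, ∀ b, (f ⁻¹' {b}).Infinite →
      (S ∩ f ⁻¹' {b}).Infinite ∧ (Sᶜ ∩ f ⁻¹' {b}).Infinite := by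
  have h (b : β) : ∃ t ⊆ f ⁻¹' {b}, (f ⁻¹' {b}).Infinite →
      t.Infinite ∧ (f ⁻¹' {b} \ t).Infinite := by
    by_cases hb : (f ⁻¹' {b}).Infinite
    · obtain ⟨t, u, htu, hd, hc⟩ := hb.exists_union_disjoint_cardinal_eq_of_infinite
      have hu : f ⁻¹' {b} \ t = u := by
        rw [← htu, Set.union_sdiff_left, hd.symm.sdiff_eq_left]
      have hiff : t.Infinite ↔ u.Infinite := by
        rw [← Set.infinite_coe_iff, ← Set.infinite_coe_iff, Cardinal.infinite_iff,
          Cardinal.infinite_iff, hc]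
      refine ⟨t, htu ▸ Set.subset_union_left, fun _ ↦ ?_⟩
      rw [hu, hiff, and_self, ← or_self u.Infinite]
      nth_rw 1 [← hiff]
      rwa [← Set.infinite_union, htu]
    · exact ⟨∅, Set.empty_subset _, fun h ↦ absurd h hb⟩
  choose t ht ht' using h
  refine ⟨{k | k ∈ t (f k)}, fun b hb ↦ ⟨?_, ?_⟩⟩
  · refine (ht' b hb).1.mono fun k hk ↦ ?_
    obtain rfl : f k = b := ht b hk
    exact ⟨hk, rfl⟩
  · refine (ht' b hb).2.mono ?_
    rintro k ⟨rfl, hk⟩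
    exact ⟨hk, rfl⟩

/-- An infinite set of indices on which a sequence with finite range has a property contains
an infinite fibre. -/
theorem exists_infinite_fiber_of_infinite {β : Type*} [Finite β] (f : ℕ → β) {p : β → Prop}
    (h : {k | p (f k)}.Infinite) : ∃ b, p b ∧ (f ⁻¹' {b}).Infinite := by
  by_contra! hc
  refine h ((Set.toFinite {b | p b}).biUnion (t := fun b ↦ f ⁻¹' {b}) (fun b hb ↦ ?_) |>.subset ?_)
  · simpa using hc b hb
  · intro k hk
    exact Set.mem_biUnion (x := f k) hk rfl

/-! ### Maps between cyclic groups of `l`-power order -/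

section Maps

variable (l N k : ℕ)

/-- Reduction of `ZMod (l ^ (k + N))` modulo `l ^ N`. -/
def powReduction : ZMod (l ^ (k + N)) →+ ZMod (l ^ N) :=
  (ZMod.castHom (pow_dvd_pow l (Nat.le_add_left N k)) (ZMod (l ^ N))).toAddMonoidHom

/-- The embedding of `ZMod (l ^ k)` into `ZMod (l ^ (k + N))` given by multiplication by `l ^ N`. -/
def powEmbedding : ZMod (l ^ k) →+ ZMod (l ^ (k + N)) :=
  ZMod.lift (l ^ k) ⟨zmultiplesHom _ ((l ^ N : ℕ) : ZMod (l ^ (k + N))), by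
    rw [zmultiplesHom_apply, zsmul_eq_mul, Int.cast_natCast, ← Nat.cast_mul, ← pow_add,
      ZMod.natCast_self]⟩

variable {l N k}

theorem powReduction_intCast (m : ℤ) : powReduction l N k m = m :=
  map_intCast (ZMod.castHom (pow_dvd_pow l (Nat.le_add_left N k)) (ZMod (l ^ N))) m

theorem powEmbedding_intCast (m : ℤ) :
    powEmbedding l N k m = ((m * (l ^ N : ℕ) : ℤ) : ZMod (l ^ (k + N))) := by
  rw [powEmbedding, ZMod.lift_coe, zmultiplesHom_apply]
  simp

theorem powReduction_surjective : Function.Surjective (powReduction l N k) :=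
  ZMod.castHom_surjective (pow_dvd_pow l (Nat.le_add_left N k))

theorem powReduction_eq_zero_iff {x : ZMod (l ^ (k + N))} :
    powReduction l N k x = 0 ↔ ∃ t, powEmbedding l N k t = x := by
  constructor
  · obtain ⟨m, rfl⟩ := ZMod.intCast_surjective x
    rw [powReduction_intCast, ZMod.intCast_zmod_eq_zero_iff_dvd]
    rintro ⟨c, rfl⟩
    exact ⟨c, by rw [powEmbedding_intCast, mul_comm]⟩
  · rintro ⟨t, rfl⟩
    obtain ⟨m, rfl⟩ := ZMod.intCast_surjective t
    rw [powEmbedding_intCast, powReduction_intCast, ZMod.intCast_zmod_eq_zero_iff_dvd]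
    exact dvd_mul_left _ _

theorem powEmbedding_injective [NeZero l] : Function.Injective (powEmbedding l N k) := by
  rw [injective_iff_map_eq_zero]
  intro t ht
  obtain ⟨m, rfl⟩ := ZMod.intCast_surjective t
  rw [powEmbedding_intCast, ZMod.intCast_zmod_eq_zero_iff_dvd, pow_add, Nat.cast_mul] at ht
  rw [ZMod.intCast_zmod_eq_zero_iff_dvd]
  exact Int.dvd_of_mul_dvd_mul_right (by exact_mod_cast (NeZero.ne (l ^ N))) ht

/-- For `k ≤ s`, reduction modulo `l ^ (k + N)` is compatible with the reductions modulo `l ^ N`. -/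
theorem exists_powTransition {s : ℕ} (h : k ≤ s) :
    ∃ τ : ZMod (l ^ (s + N)) →+ ZMod (l ^ (k + N)),
      ∀ x, powReduction l N k (τ x) = powReduction l N s x := by
  let τ := ZMod.castHom (pow_dvd_pow l (Nat.add_le_add_right h N)) (ZMod (l ^ (k + N)))
  refine ⟨τ.toAddMonoidHom, fun x ↦ ?_⟩
  obtain ⟨m, rfl⟩ := ZMod.intCast_surjective x
  have : τ.toAddMonoidHom m = m := map_intCast τ m
  rw [this, powReduction_intCast, powReduction_intCast]

/-- If a positive `n < k` multiplies `m` into `l ^ (k + N) ℤ`, then `m ∈ l ^ N ℤ`, because the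
`l`-part of `n` divides `l ^ k`. -/
theorem pow_dvd_of_pow_add_dvd_mul (hl : l.Prime) {n : ℕ} (hn : 0 < n) (hnk : n < k) {m : ℤ}
    (h : ((l ^ (k + N) : ℕ) : ℤ) ∣ n * m) : ((l ^ N : ℕ) : ℤ) ∣ m := by
  obtain ⟨e, n', hn', rfl⟩ := Nat.exists_eq_pow_mul_and_not_dvd hn.ne' l hl.ne_one
  have he : e ≤ k := by
    have h1 : l ^ e ≤ l ^ e * n' := Nat.le_mul_of_pos_right _ (Nat.pos_of_mul_pos_left hn)
    have h2 := Nat.lt_pow_self hl.one_lt (n := e)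
    omega
  obtain ⟨d, rfl⟩ := Nat.exists_eq_add_of_le he
  rw [add_assoc, pow_add, Nat.cast_mul, Nat.cast_mul, mul_assoc] at h
  have h' := Int.dvd_of_mul_dvd_mul_left (by exact_mod_cast (pow_ne_zero e hl.ne_zero)) h
  have hco : IsCoprime ((l ^ (d + N) : ℕ) : ℤ) (n' : ℤ) :=
    Nat.isCoprime_iff_coprime.2 (((Nat.Prime.coprime_iff_not_dvd hl).2 hn').pow_left _)
  exact (Int.natCast_dvd_natCast.2 (pow_dvd_pow l (Nat.le_add_left N d))).trans
    (hco.dvd_of_dvd_mul_left h')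

end Maps

/-! ### Extensions of `A` as fibre products -/

/-- For a sequence `φ` of characters of `A` with values in `ZMod (l ^ N)`, the group of all
`(x, a)`, where `x` is a sequence with `x k ∈ ZMod (l ^ (k + N))` and `a ∈ A`, such that
`x k` reduces to `φ k a` modulo `l ^ N` for every `k`. Forgetting `x` makes it an extension of `A` by
`∏ k, l ^ N ZMod (l ^ (k + N)) ≃ ∏ k, ZMod (l ^ k)`. -/
def charFiberProduct {l N : ℕ} {A : Type*} [AddCommGroup A] (φ : ℕ → A →+ ZMod (l ^ N)) :
    AddSubgroup (((k : ℕ) → ZMod (l ^ (k + N))) × A) where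
  carrier := {p | ∀ k, powReduction l N k (p.1 k) = φ k p.2}
  zero_mem' k := by simp
  add_mem' ha hb k := by simp [ha k, hb k]
  neg_mem' ha k := by simp [ha k]

section FiberProduct

variable {l N : ℕ} {A : Type*} [AddCommGroup A] {φ : ℕ → A →+ ZMod (l ^ N)}

theorem mem_charFiberProduct {p : ((k : ℕ) → ZMod (l ^ (k + N))) × A} :
    p ∈ charFiberProduct φ ↔ ∀ k, powReduction l N k (p.1 k) = φ k p.2 := Iff.rfl

/-- If `φ k a = 0` for all but finitely many `k`, then `a` lifts to a torsion
element. -/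
theorem exists_torsion_lift [NeZero l] (hA : ∀ a : A, l ^ N • a = 0) {a : A}
    (ha : {k | φ k a ≠ 0}.Finite) :
    ∃ p : charFiberProduct φ, p ∈ AddCommGroup.torsion (charFiberProduct φ) ∧ p.1.2 = a := by
  classical
  choose x hx using fun k ↦ powReduction_surjective (l := l) (N := N) (k := k) (φ k a)
  obtain ⟨b, hb⟩ := ha.bddAbove
  refine ⟨⟨(fun k ↦ if φ k a = 0 then 0 else x k, a), fun k ↦ ?_⟩, ?_, rfl⟩
  · dsimp only
    split_ifs with h
    · rw [map_zero, h]
    · exact hx k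
  · refine isOfFinAddOrder_iff_nsmul_eq_zero.2
      ⟨l ^ (b + N), Nat.pos_of_ne_zero (NeZero.ne _), ?_⟩
    refine Subtype.ext (Prod.ext (funext fun k ↦ ?_) ?_)
    · change l ^ (b + N) • (if φ k a = 0 then 0 else x k) = 0
      split_ifs with h
      · exact nsmul_zero _
      · obtain ⟨c, hc⟩ := pow_dvd_pow l (Nat.add_le_add_right (hb h) N)
        rw [hc, mul_nsmul, nsmul_eq_mul (l ^ (k + N)), ZMod.natCast_self, zero_mul, nsmul_zero]
    · change l ^ (b + N) • a = 0
      rw [pow_add, mul_comm, mul_nsmul, hA, nsmul_zero]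

/-- If `φ k a ≠ 0` for infinitely many `k`, no torsion element lies over `a`: were `(x, a)` killed by
`n`, then `x k` would be divisible by `l ^ N` for all `k > n`. -/
theorem snd_eq_zero_of_mem_torsion (hl : l.Prime)
    (hφ : ∀ a : A, a ≠ 0 → {k | φ k a ≠ 0}.Infinite) {p : charFiberProduct φ}
    (hp : p ∈ AddCommGroup.torsion (charFiberProduct φ)) : p.1.2 = 0 := by
  by_contra ha
  obtain ⟨n, hn, h⟩ := isOfFinAddOrder_iff_nsmul_eq_zero.1 hp
  obtain ⟨k, hk, hnk⟩ := (hφ _ ha).exists_gt n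
  apply hk
  have hx : n • p.1.1 k = 0 := congrFun (congrArg (fun p ↦ p.1.1) h) k
  rw [← p.2 k]
  obtain ⟨m, hm⟩ := ZMod.intCast_surjective (p.1.1 k)
  rw [← hm] at hx ⊢
  rw [powReduction_intCast, ZMod.intCast_zmod_eq_zero_iff_dvd]
  rw [nsmul_eq_mul, ← Int.cast_natCast, ← Int.cast_mul, ZMod.intCast_zmod_eq_zero_iff_dvd] at hx
  exact pow_dvd_of_pow_add_dvd_mul hl hn hnk hx

variable [TopologicalSpace A]

/-- The continuous embedding of `∏ k, ZMod (l ^ k)` as the kernel of the projection to `A`. -/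
def charFiberProductInl (φ : ℕ → A →+ ZMod (l ^ N)) :
    ((k : ℕ) → ZMod (l ^ k)) →ₜ+ charFiberProduct φ where
  toFun t := ⟨(fun k ↦ powEmbedding l N k (t k), 0), fun k ↦ by
    rw [map_zero, powReduction_eq_zero_iff]; exact ⟨_, rfl⟩⟩
  map_zero' := by ext <;> simp
  map_add' s t := by ext <;> simp
  continuous_toFun := by
    refine Continuous.subtype_mk (Continuous.prodMk (continuous_pi fun k ↦ ?_) continuous_const) _
    exact continuous_of_discreteTopology.comp (continuous_apply k)

theorem charFiberProductInl_injective [NeZero l] :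
    Function.Injective (charFiberProductInl φ) := fun _ _ h ↦ funext fun k ↦
  powEmbedding_injective (congrFun (congrArg (fun p ↦ p.1.1) h) k)

/-- The projection of the fibre product to `A`. -/
def charFiberProductSnd (φ : ℕ → A →+ ZMod (l ^ N)) : charFiberProduct φ →ₜ+ A where
  toFun p := p.1.2
  map_zero' := rfl
  map_add' _ _ := rfl
  continuous_toFun := continuous_snd.comp continuous_subtype_val

theorem charFiberProduct_exact :
    Function.Exact (charFiberProductInl φ) (charFiberProductSnd φ) := by
  intro p
  constructor
  · intro (h : p.1.2 = 0)
    have hp (k : ℕ) : powReduction l N k (p.1.1 k) = 0 := by rw [p.2 k, h, map_zero]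
    choose t ht using fun k ↦ powReduction_eq_zero_iff.1 (hp k)
    exact ⟨t, Subtype.ext (Prod.ext (funext ht) h.symm)⟩
  · rintro ⟨t, rfl⟩
    rfl

theorem tendsto_pow_nsmul_charFiberProduct (hA : ∀ a : A, l ^ N • a = 0) (p : charFiberProduct φ) :
    Filter.Tendsto (fun n : ℕ ↦ l ^ n • p) Filter.atTop (nhds 0) := by
  rw [tendsto_subtype_rng, AddSubgroup.coe_zero]
  refine Filter.Tendsto.prodMk_nhds (tendsto_pi_nhds.2 fun k ↦ ?_) ?_
  · refine tendsto_const_nhds.congr' ?_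
    filter_upwards [Filter.eventually_ge_atTop (k + N)] with n hn
    obtain ⟨c, hc⟩ := pow_dvd_pow l hn
    change (0 : ZMod (l ^ (k + N))) = l ^ n • p.1.1 k
    rw [hc, mul_nsmul, nsmul_eq_mul (l ^ (k + N)), ZMod.natCast_self, zero_mul, nsmul_zero]
  · refine tendsto_const_nhds.congr' ?_
    filter_upwards [Filter.eventually_ge_atTop N] with n hn
    obtain ⟨c, hc⟩ := pow_dvd_pow l hn
    change (0 : A) = l ^ n • p.1.2
    rw [hc, mul_nsmul, hA, nsmul_zero]

variable [DiscreteTopology A]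

theorem isClosed_charFiberProduct :
    IsClosed (charFiberProduct φ : Set (((k : ℕ) → ZMod (l ^ (k + N))) × A)) := by
  have : (charFiberProduct φ : Set (((k : ℕ) → ZMod (l ^ (k + N))) × A)) =
      ⋂ k, {p | powReduction l N k (p.1 k) = φ k p.2} := by
    ext p; simp [mem_charFiberProduct]
  rw [this]
  refine isClosed_iInter fun k ↦ isClosed_eq ?_ ?_
  · exact continuous_of_discreteTopology.comp ((continuous_apply k).comp continuous_fst)
  · exact continuous_of_discreteTopology.comp continuous_snd

theorem compactSpace_charFiberProduct [NeZero l] [Finite A] :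
    CompactSpace (charFiberProduct φ) :=
  isCompact_iff_compactSpace.1 isClosed_charFiberProduct.isCompact

theorem isAddProLGroup_charFiberProduct [Finite A] (hl : l.Prime) (hA : ∀ a : A, l ^ N • a = 0) :
    IsAddProLGroup l (charFiberProduct φ) := by
  have : Fact l.Prime := ⟨hl⟩
  have : NeZero l := ⟨hl.ne_zero⟩
  have hc : CompactSpace (charFiberProduct φ) := compactSpace_charFiberProduct
  refine ⟨inferInstance, hc, inferInstance, inferInstance, fun U ↦ ?_⟩
  have : Finite (charFiberProduct φ ⧸ (U : AddSubgroup (charFiberProduct φ))) :=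
    AddSubgroup.quotient_finite_of_isOpen _ U.isOpen
  have hp : IsPGroup l
      (Multiplicative (charFiberProduct φ ⧸ (U : AddSubgroup (charFiberProduct φ)))) := by
    rw [isPGroup_iff_pow_pow_eq_one]
    intro g
    obtain ⟨p, hp⟩ := QuotientAddGroup.mk_surjective g.toAdd
    obtain ⟨n, hn⟩ := ((tendsto_pow_nsmul_charFiberProduct hA p).eventually
      (U.isOpen.mem_nhds U.zero_mem)).exists
    refine ⟨n, Multiplicative.toAdd.injective ?_⟩
    rw [toAdd_pow, ← hp, toAdd_one, ← QuotientAddGroup.mk_nsmul, QuotientAddGroup.eq_zero_iff]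
    exact hn
  exact (IsPGroup.iff_card (G :=
    Multiplicative (charFiberProduct φ ⧸ (U : AddSubgroup (charFiberProduct φ))))).1 hp

theorem dense_torsion_pi_zmod [NeZero l] :
    Dense (AddCommGroup.torsion ((k : ℕ) → ZMod (l ^ k)) : Set ((k : ℕ) → ZMod (l ^ k))) := by
  intro t
  -- The truncations of `t` are torsion elements converging to `t`.
  let u (n k : ℕ) : ZMod (l ^ k) := if k ≤ n then t k else 0
  refine mem_closure_of_tendsto (f := u) (b := Filter.atTop) ?_
    (Filter.Eventually.of_forall fun n ↦ ?_)
  · refine tendsto_pi_nhds.2 fun k ↦ tendsto_const_nhds.congr' ?_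
    filter_upwards [Filter.eventually_ge_atTop k] with n hn
    exact (if_pos hn).symm
  · refine isOfFinAddOrder_iff_nsmul_eq_zero.2
      ⟨l ^ n, Nat.pos_of_ne_zero (NeZero.ne _), funext fun k ↦ ?_⟩
    change l ^ n • (if k ≤ n then t k else 0) = 0
    split_ifs with h
    · obtain ⟨c, hc⟩ := pow_dvd_pow l h
      rw [hc, mul_nsmul, nsmul_eq_mul (l ^ k), ZMod.natCast_self, zero_mul, nsmul_zero]
    · exact nsmul_zero _

theorem isTorsionClosureExtension_charFiberProduct (hl : l.Prime)
    (hφ : ∀ a : A, a ≠ 0 → {k | φ k a ≠ 0}.Infinite) :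
    IsTorsionClosureExtension ((k : ℕ) → ZMod (l ^ k)) (charFiberProduct φ) A := by
  have : NeZero l := ⟨hl.ne_zero⟩
  refine ⟨charFiberProductInl φ, charFiberProductSnd φ, charFiberProductInl_injective,
    charFiberProduct_exact, fun a ↦ ?_, Set.Subset.antisymm ?_ ?_⟩
  · choose x hx using fun k ↦ powReduction_surjective (l := l) (N := N) (k := k) (φ k a)
    exact ⟨⟨(x, a), hx⟩, rfl⟩
  · refine closure_minimal (fun p hp ↦ ?_) ?_
    · exact (charFiberProduct_exact p).1 (snd_eq_zero_of_mem_torsion hl hφ hp)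
    · exact (isCompact_range (map_continuous _)).isClosed
  · rintro _ ⟨t, rfl⟩
    refine map_mem_closure (map_continuous _) (dense_torsion_pi_zmod t) fun s hs ↦ ?_
    exact AddMonoidHom.isOfFinAddOrder (charFiberProductInl φ : _ →+ charFiberProduct φ) hs

end FiberProduct

/-! ### Coordinates on a given extension -/

section Coordinates

variable {l N : ℕ} {A : Type*} [AddCommGroup A]

/-- A bijective continuous homomorphism from a compact group to a Hausdorff group is an
isomorphism of topological groups. -/
noncomputable def continuousAddEquivOfBijective {G H : Type*} [AddGroup G] [AddGroup H]
    [TopologicalSpace G] [TopologicalSpace H] [CompactSpace G] [T2Space H] (f : G →+ H)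
    (hc : Continuous f) (hf : Function.Bijective f) : G ≃ₜ+ H :=
  { AddEquiv.ofBijective f hf with
    continuous_toFun := hc
    continuous_invFun :=
      (Continuous.homeoOfEquivCompactToT2 (f := Equiv.ofBijective f hf) hc).symm.continuous }

/-- A homomorphism is continuous if its restriction to an open subgroup is. -/
theorem continuous_of_continuous_comp_isOpenEmbedding {G H K : Type*} [AddCommGroup G]
    [AddCommGroup H] [AddCommGroup K] [TopologicalSpace G] [TopologicalSpace H]
    [TopologicalSpace K] [IsTopologicalAddGroup G] [IsTopologicalAddGroup K] {i : H →+ G}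
    (hi : Topology.IsOpenEmbedding i) (F : G →+ K) (hF : Continuous (F ∘ i)) : Continuous F := by
  refine continuous_of_continuousAt_zero F ?_
  rw [← map_zero i]
  exact hi.continuousAt_iff.1 hF.continuousAt

variable [TopologicalSpace A] [DiscreteTopology A]

/-- Every extension of `A` by `∏ k, ZMod (l ^ k)` is a fibre product: the coordinates of
`∏ k, ZMod (l ^ k)`, viewed in `ZMod (l ^ (k + N))`, extend to the whole group, and modulo `l ^ N`
the extensions factor through `A`. -/
theorem exists_continuousAddEquiv_charFiberProduct [NeZero l] (hA : ∀ a : A, l ^ N • a = 0)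
    {D : Type*} [AddCommGroup D] [TopologicalSpace D] [IsTopologicalAddGroup D] [CompactSpace D]
    [T2Space D] (i : ((k : ℕ) → ZMod (l ^ k)) →ₜ+ D) (q : D →ₜ+ A)
    (hi : Function.Injective i) (hiq : Function.Exact i q) (hq : Function.Surjective q) :
    ∃ (φ : ℕ → A →+ ZMod (l ^ N)) (e : D ≃ₜ+ charFiberProduct φ), ∀ d, (e d).1.2 = q d := by
  have hext (k : ℕ) : ∃ X : D →+ ZMod (l ^ (k + N)), ∀ t, X (i t) = powEmbedding l N k (t k) := by
    refine exists_zmodHom_extension (i : ((k : ℕ) → ZMod (l ^ k)) →+ D) hi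
      ((powEmbedding l N k).comp (Pi.evalAddMonoidHom (fun k ↦ ZMod (l ^ k)) k)) fun d ↦ ?_
    -- `l ^ N • d` is in the image of `i`, and the `k`th coordinate is killed by a further `l ^ k`.
    obtain ⟨t, ht⟩ := (hiq (l ^ N • d)).1 (by rw [map_nsmul, hA])
    refine ⟨l ^ k • t, ?_, ?_⟩
    · change powEmbedding l N k (l ^ k • t k) = 0
      rw [nsmul_eq_mul (l ^ k), ZMod.natCast_self, zero_mul, map_zero]
    · change i (l ^ k • t) = _
      rw [map_nsmul, ht, ← mul_nsmul, pow_add, mul_comm]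
  choose X hX using hext
  have hφ (k : ℕ) : ∃ φ : A →+ ZMod (l ^ N), ∀ d, φ (q d) = powReduction l N k (X k d) := by
    have hker : (q : D →+ A).ker ≤ ((powReduction l N k).comp (X k)).ker := by
      intro d hd
      obtain ⟨t, rfl⟩ := (hiq d).1 hd
      change powReduction l N k (X k (i t)) = 0
      rw [hX, powReduction_eq_zero_iff]
      exact ⟨_, rfl⟩
    exact ⟨(q : D →+ A).liftOfSurjective hq ⟨_, hker⟩,
      (q : D →+ A).liftOfRightInverse_comp_apply _ _ ⟨_, hker⟩⟩
  choose φ hφ using hφ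
  have hopen : Topology.IsOpenEmbedding i := by
    refine ⟨((map_continuous i).isClosedEmbedding hi).isEmbedding, ?_⟩
    have : Set.range i = q ⁻¹' {0} := Set.ext fun d ↦ (hiq d).symm
    rw [this]
    exact (isOpen_discrete _).preimage (map_continuous q)
  have hXc (k : ℕ) : Continuous (X k) := by
    refine continuous_of_continuous_comp_isOpenEmbedding
      (i := (i : ((k : ℕ) → ZMod (l ^ k)) →+ D)) hopen _ ?_
    have : X k ∘ i = powEmbedding l N k ∘ fun t ↦ t k := funext (hX k)
    exact this ▸ continuous_of_discreteTopology.comp (continuous_apply k)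
  let f : D →+ charFiberProduct φ :=
    { toFun d := ⟨(fun k ↦ X k d, q d), fun k ↦ (hφ k d).symm⟩
      map_zero' := by ext <;> simp
      map_add' a b := by ext <;> simp }
  have hfc : Continuous f :=
    ((continuous_pi hXc).prodMk (map_continuous q)).subtype_mk _
  have hf : Function.Bijective f := by
    constructor
    · rw [injective_iff_map_eq_zero]
      intro d hd
      obtain ⟨t, rfl⟩ := (hiq d).1 (congrArg (fun p ↦ p.1.2) hd)
      rw [show t = 0 from funext fun k ↦ powEmbedding_injective (N := N) ?_, map_zero]
      rw [← hX]
      exact (congrFun (congrArg (fun p ↦ p.1.1) hd) k).trans (map_zero (powEmbedding l N k)).symm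
    · rintro ⟨⟨x, a⟩, hx⟩
      obtain ⟨d, rfl⟩ := hq a
      have (k : ℕ) : powReduction l N k (x k - X k d) = 0 := by
        rw [map_sub, ← hφ, sub_eq_zero]
        exact hx k
      choose t ht using fun k ↦ powReduction_eq_zero_iff.1 (this k)
      refine ⟨i t + d, Subtype.ext (Prod.ext (funext fun k ↦ ?_) ?_)⟩
      · change X k (i t + d) = x k
        rw [map_add, hX, ht, sub_add_cancel]
      · change q (i t + d) = q d
        rw [map_add, (hiq _).2 ⟨t, rfl⟩, zero_add]
  exact ⟨φ, continuousAddEquivOfBijective f hfc hf, fun d ↦ rfl⟩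

/-- If the closure of the torsion subgroup maps to zero in `A`, the characters that describe the
extension separate the points of `A` infinitely often. -/
theorem IsTorsionClosureExtension.exists_continuousAddEquiv [NeZero l]
    (hA : ∀ a : A, l ^ N • a = 0)
    {D : Type*} [AddCommGroup D] [TopologicalSpace D] [IsTopologicalAddGroup D] [CompactSpace D]
    [T2Space D] (h : IsTorsionClosureExtension ((k : ℕ) → ZMod (l ^ k)) D A) :
    ∃ φ : ℕ → A →+ ZMod (l ^ N), (∀ a, a ≠ 0 → {k | φ k a ≠ 0}.Infinite) ∧
      Nonempty (D ≃ₜ+ charFiberProduct φ) := by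
  obtain ⟨i, q, hi, hiq, hq, hcl⟩ := h
  obtain ⟨φ, e, he⟩ := exists_continuousAddEquiv_charFiberProduct hA i q hi hiq hq
  refine ⟨φ, fun a ha hfin ↦ ha ?_, ⟨e⟩⟩
  obtain ⟨p, hp, rfl⟩ := exists_torsion_lift hA hfin
  have hd : e.symm p ∈ AddCommGroup.torsion D :=
    AddMonoidHom.isOfFinAddOrder (e.symm : charFiberProduct φ →+ D) hp
  rw [← e.apply_symm_apply p, he]
  exact (hiq _).2 (hcl ▸ subset_closure hd)

end Coordinates

/-! ### Shears between fibre products -/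

section Shear

variable {l N : ℕ} {A : Type*} [AddCommGroup A]

/-- A character `χ` in the group generated by the characters `φ s` with `s ∈ S` and `k ≤ s` is the
reduction of a homomorphism to `ZMod (l ^ (k + N))` that depends only on the coordinates in `S`. -/
theorem exists_hom_of_mem_closure {φ : ℕ → A →+ ZMod (l ^ N)} {S : Set ℕ} {k : ℕ}
    {χ : A →+ ZMod (l ^ N)} (hχ : χ ∈ AddSubgroup.closure (φ '' {s | s ∈ S ∧ k ≤ s})) :
    ∃ g : ((s : ℕ) → ZMod (l ^ (s + N))) →ₜ+ ZMod (l ^ (k + N)),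
      (∀ x y, (∀ s ∈ S, x s = y s) → g x = g y) ∧
      ∀ x a, (∀ s ∈ S, powReduction l N s (x s) = φ s a) → powReduction l N k (g x) = χ a := by
  induction hχ using AddSubgroup.closure_induction with
  | mem χ hχ =>
    obtain ⟨s, ⟨hs, hks⟩, rfl⟩ := hχ
    obtain ⟨τ, hτ⟩ := exists_powTransition (l := l) (N := N) hks
    have hc : Continuous (τ ∘ fun x : (s : ℕ) → ZMod (l ^ (s + N)) ↦ x s) :=
      continuous_of_discreteTopology.comp (continuous_apply s)
    refine ⟨⟨τ.comp (Pi.evalAddMonoidHom (fun s ↦ ZMod (l ^ (s + N))) s), hc⟩,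
      fun x y h ↦ ?_, fun x a h ↦ ?_⟩
    · exact congrArg τ (h s hs)
    · exact (hτ _).trans (h s hs)
  | zero => exact ⟨0, fun _ _ _ ↦ rfl, fun _ _ _ ↦ map_zero _⟩
  | add χ χ' _ _ ih ih' =>
    obtain ⟨g, hg, hg'⟩ := ih
    obtain ⟨f, hf, hf'⟩ := ih'
    refine ⟨g + f, fun x y h ↦ ?_, fun x a h ↦ ?_⟩
    · exact congrArg₂ (· + ·) (hg x y h) (hf x y h)
    · exact (map_add _ _ _).trans (congrArg₂ (· + ·) (hg' x a h) (hf' x a h))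
  | neg χ _ ih =>
    obtain ⟨g, hg, hg'⟩ := ih
    refine ⟨-g, fun x y h ↦ ?_, fun x a h ↦ ?_⟩
    · exact congrArg (- ·) (hg x y h)
    · exact (map_neg _ _).trans (congrArg (- ·) (hg' x a h))

theorem exists_separating_zmodChar_sequence [NeZero l] [Finite A] (hA : ∀ a : A, l ^ N • a = 0) :
    ∃ φ : ℕ → A →+ ZMod (l ^ N), ∀ a, a ≠ 0 → {k | φ k a ≠ 0}.Infinite := by
  have : Finite (A →+ ZMod (l ^ N)) := finite_zmodChar
  obtain ⟨e, he⟩ := exists_surjective_nat (A →+ ZMod (l ^ N))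
  -- Unpairing makes every character occur infinitely often.
  refine ⟨fun k ↦ e k.unpair.1, fun a ha ↦ ?_⟩
  obtain ⟨χ, hχ⟩ := exists_zmodChar_ne_zero hA ha
  obtain ⟨n, rfl⟩ := he χ
  refine Set.infinite_of_injective_forall_mem (f := fun m ↦ Nat.pair n m) ?_ ?_
  · intro m m' h
    exact (Nat.pair_eq_pair.1 h).2
  · intro m
    change e (Nat.pair n m).unpair.1 a ≠ 0
    rwa [Nat.unpair_pair]

variable [TopologicalSpace A]

open Classical in
/-- If two character sequences agree on `S`, and the characters of arbitrarily large index in `S`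
generate all characters, then a shear that adds combinations of the coordinates in `S` to the other
coordinates is an isomorphism of the two fibre products. -/
theorem nonempty_continuousAddEquiv_of_eqOn {φ θ : ℕ → A →+ ZMod (l ^ N)} {S : Set ℕ}
    (hS : ∀ k, AddSubgroup.closure (φ '' {s | s ∈ S ∧ k ≤ s}) = ⊤) (hφθ : ∀ s ∈ S, φ s = θ s) :
    Nonempty (charFiberProduct φ ≃ₜ+ charFiberProduct θ) := by
  choose g hg hg' using fun k ↦ exists_hom_of_mem_closure (l := l) (N := N) (φ := φ) (S := S)
    (k := k) (χ := θ k - φ k) (hS k ▸ AddSubgroup.mem_top _)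
  -- `h k` vanishes for `k ∈ S` and depends only on the coordinates in `S`, which the shear by `h`
  -- therefore leaves unchanged; so the shear by `-h` is its inverse.
  let h (k : ℕ) : ((s : ℕ) → ZMod (l ^ (s + N))) →ₜ+ ZMod (l ^ (k + N)) :=
    if k ∈ S then 0 else g k
  have hhS (k : ℕ) (hk : k ∈ S) (x) : h k x = 0 := by simp only [h, if_pos hk]; rfl
  have hh (k : ℕ) (x y) (hxy : ∀ s ∈ S, x s = y s) : h k x = h k y := by
    by_cases hk : k ∈ S
    · rw [hhS k hk, hhS k hk]
    · simp only [h, if_neg hk]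
      exact hg k x y hxy
  have hh' (k : ℕ) (x a) (hx : ∀ s ∈ S, powReduction l N s (x s) = φ s a) :
      powReduction l N k (h k x) = θ k a - φ k a := by
    by_cases hk : k ∈ S
    · rw [hhS k hk, map_zero, hφθ k hk, sub_self]
    · simp only [h, if_neg hk]
      exact hg' k x a hx
  refine ⟨
    { toFun p := ⟨(fun k ↦ p.1.1 k + h k p.1.1, p.1.2), fun k ↦ ?_⟩
      invFun p := ⟨(fun k ↦ p.1.1 k - h k p.1.1, p.1.2), fun k ↦ ?_⟩
      left_inv p := Subtype.ext (Prod.ext (funext fun k ↦ ?_) rfl)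
      right_inv p := Subtype.ext (Prod.ext (funext fun k ↦ ?_) rfl)
      map_add' p p' := Subtype.ext (Prod.ext (funext fun k ↦ ?_) rfl)
      continuous_toFun := ?_
      continuous_invFun := ?_ }⟩
  · dsimp only
    rw [map_add, p.2 k, hh' k p.1.1 p.1.2 fun s _ ↦ p.2 s, add_sub_cancel]
  · dsimp only
    rw [map_sub, p.2 k, hh' k p.1.1 p.1.2 fun s hs ↦ (p.2 s).trans (by rw [hφθ s hs]),
      sub_sub_cancel]
  · dsimp only
    rw [hh k (fun k ↦ p.1.1 k + h k p.1.1) p.1.1 fun s hs ↦ by rw [hhS s hs, add_zero],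
      add_sub_cancel_right]
  · dsimp only
    rw [hh k (fun k ↦ p.1.1 k - h k p.1.1) p.1.1 fun s hs ↦ by rw [hhS s hs, sub_zero],
      sub_add_cancel]
  · change (p.1.1 + p'.1.1) k + h k (p.1.1 + p'.1.1) = _
    rw [map_add]
    exact add_add_add_comm _ _ _ _
  · fun_prop
  · fun_prop

/-- Two fibre products are isomorphic as soon as both character sequences separate the points of `A`
infinitely often. -/
theorem nonempty_continuousAddEquiv_charFiberProduct [NeZero l] [Finite A]
    (hA : ∀ a : A, l ^ N • a = 0) {φ ψ : ℕ → A →+ ZMod (l ^ N)}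
    (hφ : ∀ a, a ≠ 0 → {k | φ k a ≠ 0}.Infinite) (hψ : ∀ a, a ≠ 0 → {k | ψ k a ≠ 0}.Infinite) :
    Nonempty (charFiberProduct φ ≃ₜ+ charFiberProduct ψ) := by
  classical
  have : Finite (A →+ ZMod (l ^ N)) := finite_zmodChar
  obtain ⟨S, hS⟩ := exists_infinite_fiber_split fun k ↦ (φ k, ψ k)
  let θ (k : ℕ) : A →+ ZMod (l ^ N) := if k ∈ S then φ k else ψ k
  have hgen {χ : ℕ → A →+ ZMod (l ^ N)} {R : Set ℕ}
      (hR : ∀ a, a ≠ 0 → (R ∩ {k | χ k a ≠ 0}).Infinite) (k : ℕ) :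
      AddSubgroup.closure (χ '' {s | s ∈ R ∧ k ≤ s}) = ⊤ := by
    refine zmodChar_subgroup_eq_top hA _ fun a ha ↦ ?_
    obtain ⟨s, ⟨hs, hsa⟩, hks⟩ := (hR a ha).exists_gt k
    exact ⟨χ s, AddSubgroup.subset_closure ⟨s, ⟨hs, hks.le⟩, rfl⟩, hsa⟩
  have h1 : Nonempty (charFiberProduct φ ≃ₜ+ charFiberProduct θ) := by
    refine nonempty_continuousAddEquiv_of_eqOn (S := S) (hgen fun a ha ↦ ?_)
      fun s hs ↦ (if_pos hs).symm
    obtain ⟨b, hb, hinf⟩ := exists_infinite_fiber_of_infinite (fun k ↦ (φ k, ψ k))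
      (p := fun b ↦ b.1 a ≠ 0) (hφ a ha)
    refine (hS b hinf).1.mono ?_
    rintro k ⟨hk, rfl⟩
    exact ⟨hk, hb⟩
  have h2 : Nonempty (charFiberProduct ψ ≃ₜ+ charFiberProduct θ) := by
    refine nonempty_continuousAddEquiv_of_eqOn (S := Sᶜ) (hgen fun a ha ↦ ?_)
      fun s hs ↦ (if_neg hs).symm
    obtain ⟨b, hb, hinf⟩ := exists_infinite_fiber_of_infinite (fun k ↦ (φ k, ψ k))
      (p := fun b ↦ b.2 a ≠ 0) (hψ a ha)
    refine (hS b hinf).2.mono ?_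
    rintro k ⟨hk, rfl⟩
    exact ⟨hk, hb⟩
  exact ⟨h1.some.trans h2.some.symm⟩

end Shear

/-! ### Existence and uniqueness -/

theorem IsTorsionClosureExtension.congr {T T' D A A' : Type*} [AddCommGroup T] [TopologicalSpace T]
    [AddCommGroup T'] [TopologicalSpace T'] [AddCommGroup D] [TopologicalSpace D]
    [AddCommGroup A] [TopologicalSpace A] [AddCommGroup A'] [TopologicalSpace A']
    (h : IsTorsionClosureExtension T D A) (e : T' ≃ₜ+ T) (f : A ≃ₜ+ A') :
    IsTorsionClosureExtension T' D A' := by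
  obtain ⟨i, q, hi, hiq, hq, hcl⟩ := h
  refine ⟨i.comp (e : T' →ₜ+ T), (f : A →ₜ+ A').comp q, hi.comp e.injective, fun d ↦ ?_,
    f.surjective.comp hq, ?_⟩
  · change f (q d) = 0 ↔ d ∈ Set.range (i ∘ e)
    rw [e.surjective.range_comp, ← hiq d, map_eq_zero_iff f f.injective]
  · change _ = Set.range (i ∘ e)
    rw [e.surjective.range_comp, hcl]

universe v w

/-- The theorem with named universes, which the proof needs in order to move `A` into the universe
of `D`. -/
theorem exists_unique_torsionClosureExtension {l : ℕ} (hl : l.Prime)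
    {T : Type*} [AddCommGroup T] [TopologicalSpace T]
    (hT : Nonempty (T ≃ₜ+ ((k : ℕ) → ZMod (l ^ k))))
    {A : Type*} [AddCommGroup A] [TopologicalSpace A] [DiscreteTopology A] [Finite A]
    (hA : ∃ n : ℕ, Nat.card A = l ^ n) :
    ∃ (D : Type v) (_ : AddCommGroup D) (_ : TopologicalSpace D),
      (IsAddProLGroup l D ∧ IsTorsionClosureExtension T D A) ∧
      ∀ (D' : Type w) [AddCommGroup D'] [TopologicalSpace D'],
        IsAddProLGroup l D' → IsTorsionClosureExtension T D' A → Nonempty (D' ≃ₜ+ D) := by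
  have : NeZero l := ⟨hl.ne_zero⟩
  obtain ⟨eT⟩ := hT
  obtain ⟨N, hN⟩ := hA
  -- `D` may live in a universe other than that of `A`, so `A` is replaced by a copy there.
  have : Small.{v} A := Countable.toSmall A
  let _ : TopologicalSpace (Shrink.{v} A) := ⊥
  have : DiscreteTopology (Shrink.{v} A) := ⟨rfl⟩
  have : Finite (Shrink.{v} A) := Finite.of_equiv A (equivShrink.{v} A)
  let eA : Shrink.{v} A ≃ₜ+ A :=
    { Shrink.addEquiv (α := A) with
      continuous_toFun := continuous_of_discreteTopology
      continuous_invFun := continuous_of_discreteTopology }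
  have hA (a : Shrink.{v} A) : l ^ N • a = 0 := by
    rw [← hN, ← Nat.card_congr (equivShrink.{v} A).symm]
    exact card_nsmul_eq_zero'
  obtain ⟨φ, hφ⟩ := exists_separating_zmodChar_sequence hA
  refine ⟨charFiberProduct φ, inferInstance, inferInstance,
    ⟨isAddProLGroup_charFiberProduct hl hA,
      (isTorsionClosureExtension_charFiberProduct hl hφ).congr eT eA⟩, ?_⟩
  intro D' _ _ hD' hext
  have := hD'.isTopologicalAddGroup
  have := hD'.compactSpace
  have := hD'.t2Space
  obtain ⟨ψ, hψ, ⟨e⟩⟩ := (hext.congr eT.symm eA.symm).exists_continuousAddEquiv hA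
  obtain ⟨e'⟩ := nonempty_continuousAddEquiv_charFiberProduct hA hψ hφ
  exact ⟨e.trans e'⟩

theorem theorem4 {l : ℕ} (hl : l.Prime)
    {T : Type*} [AddCommGroup T] [TopologicalSpace T]
    (hT : Nonempty (T ≃ₜ+ ((k : ℕ) → ZMod (l ^ k))))
    {A : Type*} [AddCommGroup A] [TopologicalSpace A] [DiscreteTopology A] [Finite A]
    (hA : ∃ n : ℕ, Nat.card A = l ^ n) :
    ∃ (D : Type*) (_ : AddCommGroup D) (_ : TopologicalSpace D),
      (IsAddProLGroup l D ∧ IsTorsionClosureExtension T D A) ∧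
      ∀ (D' : Type*) [AddCommGroup D'] [TopologicalSpace D'],
        IsAddProLGroup l D' → IsTorsionClosureExtension T D' A → Nonempty (D' ≃ₜ+ D) := by
  exact exists_unique_torsionClosureExtension hl hT hA
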